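/- Let $n\ge 0$ and let $f:\mathbb{R}^n\to\mathbb{R}^n$ be monotone for the coordinatewise order ($x\le y\Rightarrow f(x)\le f(y)$), additively homogeneous ($f(\lambda+x)=\lambda+f(x)$ for all $\lambda\in\mathbb{R}$ and $x\in\mathbb{R}^n$, where the scalar $\lambda$ is added to every coordinate) and convex (each coordinate function is convex). An eigenvector of $f$ is a vector $v\in\mathbb{R}^n$ with $f(v)=\lambda+v$ for some $\lambda\in\mathbb{R}$. For $v\in\mathbb{R}^n$ put $$\partial f(v)=\{P\in\mathbb{R}^{n\times n}: f(y)-f(v)\ge P(y-v)\ \text{for all } y\in\mathbb{R}^n\}.$$ The graph $\mathscr{G}(P)$ of a matrix $P$ has nodes $1,\dots,n$ and an arc $i\to j$ whenever $P_{ij}\ne 0$. The classes of a directed graph are the equivalence classes of its nodes for mutual accessibility by directed paths (every node has access to itself), its strongly connected components are its restrictions to its classes, and a class is final if no node of it has access to a node outside it. The final graph of $P$ is the union of the restrictions of $\mathscr{G}(P)$ to its final classes. For an eigenvector $v$ of $f$, the critical graph $\mathscr{G}^{\rm c}(f)$ of $f$ is the union of the final graphs of the matrices $P\in\partial f(v)$,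 and the cyclicity $\mathsf{c}(f)$ is the least common multiple, over the strongly connected components of $\mathscr{G}^{\rm c}(f)$, of the greatest common divisor of the lengths of the circuits of the component (with $\mathsf{c}(f)=1$ if the graph is empty, that is, if $n=0$). **Theorem.** Suppose that $f$ has a periodic orbit, that is, $x\in\mathbb{R}^n$ satisfies $f^k(x)=x$ for some $k\ge 1$. Then $f$ has an eigenvector, and, whichever eigenvector $v$ is used to define $\mathscr{G}^{\rm c}(f)$, the length of the orbit of $x$ (the least $k\ge1$ with $f^k(x)=x$) divides $\mathsf{c}(f)$. -/

import Mathlib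

namespace ConvexSpectral

/-- A directed graph with node set `nodes ⊆ ι` and arcs between its nodes; loops are allowed. -/
structure DiGraph (ι : Type*) where
  nodes : Set ι
  Arc : ι → ι → Prop
  left_mem : ∀ {i j}, Arc i j → i ∈ nodes
  right_mem : ∀ {i j}, Arc i j → j ∈ nodes

namespace DiGraph

variable {ι : Type*}

/-- `i` has access to `j`: there is a directed path from `i` to `j`, or `i = j`. -/
def HasAccess (G : DiGraph ι) (i j : ι) : Prop :=
  Relation.ReflTransGen G.Arc i j

/-- The classes of `G`: equivalence classes of nodes for mutual access. -/
def IsClass (G : DiGraph ι) (C : Set ι) : Prop :=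
  ∃ i ∈ G.nodes, C = {j | j ∈ G.nodes ∧ G.HasAccess i j ∧ G.HasAccess j i}

/-- A class is final if none of its nodes has access to a node outside of it. -/
def IsFinalClass (G : DiGraph ι) (C : Set ι) : Prop :=
  G.IsClass C ∧ ∀ i ∈ C, ∀ j ∈ G.nodes, G.HasAccess i j → j ∈ C

/-- The subgraph of `G` with node set `C` (intersected with the nodes of `G`) and all the arcs
of `G` between nodes of `C`. For a class `C` this is a strongly connected component of `G`. -/
def restrict (G : DiGraph ι) (C : Set ι) : DiGraph ι where
  nodes := G.nodes ∩ C
  Arc i j := G.Arc i j ∧ i ∈ C ∧ j ∈ C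
  left_mem h := ⟨G.left_mem h.1, h.2.1⟩
  right_mem h := ⟨G.right_mem h.1, h.2.2⟩

/-- The union of a family of graphs. -/
def iUnion {κ : Sort*} (G : κ → DiGraph ι) : DiGraph ι where
  nodes := {i | ∃ k, i ∈ (G k).nodes}
  Arc i j := ∃ k, (G k).Arc i j
  left_mem h := h.imp fun k hk => (G k).left_mem hk
  right_mem h := h.imp fun k hk => (G k).right_mem hk

/-- `k ≥ 1` is the length of a circuit `p 0 → p 1 → ⋯ → p k = p 0` of `G`. -/
def IsCircuitLength (G : DiGraph ι) (k : ℕ) : Prop :=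
  0 < k ∧ ∃ p : ℕ → ι, (∀ t < k, G.Arc (p t) (p (t + 1))) ∧ p k = p 0

/-- The gcd of the lengths of the circuits of `G`: the cyclicity of a strongly connected graph. -/
noncomputable def circuitGcd (G : DiGraph ι) : ℕ :=
  Nat.setGcd {k | G.IsCircuitLength k}

/-- The cyclicity of a graph: the lcm, over its classes `C`, of the cyclicity of the strongly
connected component with node set `C`; it is `1` for the empty graph. -/
noncomputable def cyclicity [Finite ι] (G : DiGraph ι) : ℕ :=
  (Set.toFinite {C : Set ι | G.IsClass C}).toFinset.lcm fun C => (G.restrict C).circuitGcd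

end DiGraph

/-- The graph of a matrix: an arc `i → j` for each nonzero entry `P i j`. -/
def matrixGraph {n : ℕ} (P : Matrix (Fin n) (Fin n) ℝ) : DiGraph (Fin n) where
  nodes := Set.univ
  Arc i j := P i j ≠ 0
  left_mem _ := Set.mem_univ _
  right_mem _ := Set.mem_univ _

/-- The final graph of a matrix: the union, over its final classes `F`, of the restriction of the
graph of the matrix to `F`. -/
def finalGraph {n : ℕ} (P : Matrix (Fin n) (Fin n) ℝ) : DiGraph (Fin n) :=
  DiGraph.iUnion fun F : {F : Set (Fin n) // (matrixGraph P).IsFinalClass F} =>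
    (matrixGraph P).restrict F

/-- Additive homogeneity: `f (a + x) = a + f x`, the scalar `a` being added to every coordinate. -/
def IsHomogeneous {n : ℕ} (f : (Fin n → ℝ) → (Fin n → ℝ)) : Prop :=
  ∀ (a : ℝ) (x : Fin n → ℝ), f (fun i => a + x i) = fun i => a + f x i

/-- `f` is convex if each of its coordinates is a convex function. -/
def IsConvexMap {n : ℕ} (f : (Fin n → ℝ) → (Fin n → ℝ)) : Prop :=
  ∀ i, ConvexOn ℝ Set.univ fun x => f x i

/-- `v` is an (additive) eigenvector of `f`: `f v = a + v` for some real eigenvalue `a`. -/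
def IsEigenvector {n : ℕ} (f : (Fin n → ℝ) → (Fin n → ℝ)) (v : Fin n → ℝ) : Prop :=
  ∃ a : ℝ, f v = fun i => a + v i

/-- The subdifferential of `f` at `v`. -/
def subdifferential {n : ℕ} (f : (Fin n → ℝ) → (Fin n → ℝ)) (v : Fin n → ℝ) :
    Set (Matrix (Fin n) (Fin n) ℝ) :=
  {P | ∀ x, Matrix.mulVec P (x - v) ≤ f x - f v}

/-- The critical graph of `f`, computed at the eigenvector `v`: the union of the final graphs of
the matrices in the subdifferential of `f` at `v`. -/
def criticalGraph {n : ℕ} (f : (Fin n → ℝ) → (Fin n → ℝ)) (v : Fin n → ℝ) : DiGraph (Fin n) :=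
  DiGraph.iUnion fun P : {P : Matrix (Fin n) (Fin n) ℝ // P ∈ subdifferential f v} =>
    finalGraph P.1

end ConvexSpectral

/-!
Suppose `f ^ p` fixes `x`. The supremum `s` of the orbit of `x` satisfies `s ≤ f s` and has a
bounded orbit, so its iterates increase to a fixed point of `f`; comparing growth rates, every
eigenvector `v` is then fixed.

For `P ∈ ∂f(v)`, the differences `u t = f ^ t x - v` satisfy `P (u t) ≤ u (t + 1)`. Summed over a
period, this says that `∑ u t` is superharmonic, hence harmonic on the final classes of the
stochastic matrix `P`, so all these inequalities are equalities there. Jensen's inequality for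
squares then gives `u (t + 1) i = u t j` along each critical arc `i → j`. Following circuits,
`f ^ c x` and `x`, where `c` is the cyclicity, have orbits that agree on the critical nodes.

Two periodic orbits agreeing on the critical nodes are equal. Otherwise, consider the nodes at which
the gap between the orbits is extremal, breaking ties by the gap to `v`. Each has a subgradient of
`f` at `v` supported on these nodes. A matrix in `∂f(v)` with these rows has a final class among
them, so the extremal gap is attained at a critical node, where it vanishes.
-/

namespace ConvexSpectral

open Function Matrix

section PeriodicOrbit

variable {α : Type*} {f : α → α} {p : ℕ} {x : α}

theorem finite_range_iterate (hp : 0 < p) (hx : IsPeriodicPt f p x) :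
    (Set.range fun t => f^[t] x).Finite := by
  refine ((Set.finite_Iio p).image fun t => f^[t] x).subset ?_
  rintro _ ⟨t, rfl⟩
  exact ⟨t % p, Nat.mod_lt t hp, hx.iterate_mod_apply t⟩

theorem surjOn_range_iterate (hp : 0 < p) (hx : IsPeriodicPt f p x) :
    Set.SurjOn f (Set.range fun t => f^[t] x) (Set.range fun t => f^[t] x) := by
  rintro _ ⟨t, rfl⟩
  refine ⟨f^[t + (p - 1)] x, ⟨_, rfl⟩, ?_⟩
  rw [← iterate_succ_apply' f, Nat.succ_eq_add_one, add_assoc, Nat.sub_add_cancel hp,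
    iterate_add_apply, hx.eq]

end PeriodicOrbit

theorem exists_isFixedPt_of_le_map {α : Type*} [TopologicalSpace α] [T2Space α]
    [ConditionallyCompletePartialOrderSup α] [SupConvergenceClass α] {f : α → α}
    (hcont : Continuous f) (hmono : Monotone f) {s : α} (hs : s ≤ f s)
    (hbdd : BddAbove (Set.range fun t => f^[t] s)) : ∃ v, IsFixedPt f v :=
  ⟨_, isFixedPt_of_tendsto_iterate
    (tendsto_atTop_ciSup (hmono.monotone_iterate_of_le_map hs) hbdd) hcont.continuousAt⟩

theorem exists_continuousLinearMap_sub_le {E : Type*} [AddCommGroup E] [Module ℝ E]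
    [TopologicalSpace E] [IsTopologicalAddGroup E] [ContinuousSMul ℝ E] {φ : E → ℝ}
    (hφ : ConvexOn ℝ Set.univ φ) (hcont : Continuous φ) (v : E) :
    ∃ l : E →L[ℝ] ℝ, ∀ y, l (y - v) ≤ φ y - φ v := by
  have hopen : IsOpen {q : E × ℝ | q.1 ∈ Set.univ ∧ φ q.1 < q.2} := by
    simpa using isOpen_lt (hcont.comp continuous_fst) continuous_snd
  -- The hyperplane separating `(v, φ v)` from the strict epigraph is not vertical: `0 < L (0, 1)`.
  obtain ⟨L, hL⟩ := geometric_hahn_banach_point_open (x := (v, φ v))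
    hφ.convex_strict_epigraph hopen (by simp)
  have hsplit (y : E) (r : ℝ) : L (y, r) = L (y, 0) + r * L (0, 1) := by
    rw [← smul_eq_mul, ← map_smul, ← map_add]
    simp
  have hpos : 0 < L (0, 1) := by
    have h := hL (v, φ v + 1) (by simp)
    rw [hsplit, hsplit v (φ v + 1)] at h
    linarith
  refine ⟨-((L (0, 1))⁻¹ • L.comp (.inl ℝ E ℝ)), fun y => ?_⟩
  have happly : (-((L (0, 1))⁻¹ • L.comp (.inl ℝ E ℝ))) (y - v) =
      (L (v, 0) - L (y, 0)) / L (0, 1) := by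
    have hsub : L (y - v, 0) = L (y, 0) - L (v, 0) := by
      rw [← map_sub]
      simp
    simp only [_root_.neg_apply, _root_.smul_apply, ContinuousLinearMap.comp_apply,
      ContinuousLinearMap.inl_apply, hsub, smul_eq_mul]
    ring
  rw [happly, div_le_iff₀ hpos]
  refine le_of_forall_pos_lt_add fun ε hε => ?_
  have h := hL (y, φ y + ε / L (0, 1)) (by simpa using div_pos hε hpos)
  rw [hsplit, hsplit y, add_mul, div_mul_cancel₀ _ hpos.ne'] at h
  linarith

section StdSimplex

variable {ι : Type*} [Fintype ι] {r u : ι → ℝ} {a : ℝ}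

theorem dotProduct_eq_of_forall_eq (hr : r ∈ stdSimplex ℝ ι) (hu : ∀ j, r j ≠ 0 → u j = a) :
    r ⬝ᵥ u = a := by
  have hterm (j : ι) : r j * u j = r j * a := by
    by_cases hj : r j = 0
    · rw [hj, zero_mul, zero_mul]
    · rw [hu j hj]
  rw [dotProduct, Finset.sum_congr rfl fun j _ => hterm j, ← Finset.sum_mul, hr.2, one_mul]

theorem eq_of_dotProduct_le (hr : r ∈ stdSimplex ℝ ι) (hle : r ⬝ᵥ u ≤ a)
    (hmin : ∀ j, r j ≠ 0 → a ≤ u j) {j : ι} (hj : r j ≠ 0) : u j = a := by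
  have hterm (j : ι) : r j * a ≤ r j * u j := by
    by_cases hj : r j = 0
    · rw [hj, zero_mul, zero_mul]
    · exact mul_le_mul_of_nonneg_left (hmin j hj) (hr.1 j)
  have hsum : ∑ j, r j * a = ∑ j, r j * u j := by
    refine le_antisymm (Finset.sum_le_sum fun j _ => hterm j) ?_
    rwa [← Finset.sum_mul, hr.2, one_mul]
  have heq := (Finset.sum_eq_sum_iff_of_le fun j _ => hterm j).1 hsum j (Finset.mem_univ j)
  exact (mul_left_cancel₀ hj heq).symm

theorem sq_dotProduct_le (hr : r ∈ stdSimplex ℝ ι) : (r ⬝ᵥ u) ^ 2 ≤ r ⬝ᵥ u ^ 2 :=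
  even_two.convexOn_pow.map_sum_le (fun j _ => hr.1 j) hr.2 fun _ _ => Set.mem_univ _

theorem eq_dotProduct_of_sq_dotProduct_eq (hr : r ∈ stdSimplex ℝ ι)
    (heq : (r ⬝ᵥ u) ^ 2 = r ⬝ᵥ u ^ 2) {j : ι} (hj : r j ≠ 0) : u j = r ⬝ᵥ u :=
  ((even_two.strictConvexOn_pow two_ne_zero).map_sum_eq_iff' (fun j _ => hr.1 j) hr.2
    fun _ _ => Set.mem_univ _).1 heq j (Finset.mem_univ j) hj

end StdSimplex

section Subgradient

variable {ι : Type*} [Fintype ι] {φ : (ι → ℝ) → ℝ} {r v y z : ι → ℝ}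

/-- `r` is a subgradient of `φ` at `v`. The rows of the matrices in `subdifferential f v` are the
subgradients at `v` of the coordinates of `f`. -/
def IsSubgradientAt (φ : (ι → ℝ) → ℝ) (r v : ι → ℝ) : Prop :=
  ∀ y, r ⬝ᵥ (y - v) ≤ φ y - φ v

theorem exists_isSubgradientAt (hφ : ConvexOn ℝ Set.univ φ) (v : ι → ℝ) :
    ∃ r, IsSubgradientAt φ r v := by
  classical
  obtain ⟨l, hl⟩ := exists_continuousLinearMap_sub_le hφ hφ.locallyLipschitz.continuous v
  refine ⟨fun j => l (Pi.single j 1), fun y => (hl y).trans_eq' ?_⟩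
  have h := map_sum l (fun j => Pi.single j ((y - v) j)) Finset.univ
  rw [Finset.univ_sum_single] at h
  rw [h, dotProduct]
  refine Finset.sum_congr rfl fun j _ => ?_
  rw [mul_comm, ← smul_eq_mul, ← map_smul, ← Pi.single_smul, smul_eq_mul, mul_one]

theorem IsSubgradientAt.mem_stdSimplex (hr : IsSubgradientAt φ r v) (hmono : Monotone φ)
    (hhom : ∀ (a : ℝ) y, φ (fun i => a + y i) = a + φ y) : r ∈ stdSimplex ℝ ι := by
  classical
  constructor
  · intro j
    have h := hr (v - Pi.single j 1)
    have hle : φ (v - Pi.single j 1) ≤ φ v := hmono (sub_le_self v (Pi.single_nonneg.2 zero_le_one))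
    rw [sub_sub_cancel_left, dotProduct_neg, dotProduct_single_one] at h
    linarith
  · have h (a : ℝ) : (∑ j, r j) * a ≤ a := by
      have := hr fun j => a + v j
      rw [hhom] at this
      simpa [dotProduct, Finset.sum_mul] using this
    linarith [h 1, h (-1)]

theorem IsSubgradientAt.of_dotProduct_eq (hr : IsSubgradientAt φ r y)
    (h : r ⬝ᵥ (v - y) = φ v - φ y) : IsSubgradientAt φ r v := fun z => by
  have hz := hr z
  rw [← sub_add_sub_cancel z v y, dotProduct_add, h] at hz
  linarith

theorem IsSubgradientAt.of_toLex_le (hr : IsSubgradientAt φ r y) (hr₁ : r ∈ stdSimplex ℝ ι)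
    (hmin : ∀ j, toLex (φ z - φ y, φ v - φ y) ≤ toLex (z j - y j, v j - y j)) :
    IsSubgradientAt φ r v ∧
      ∀ j, r j ≠ 0 → toLex (z j - y j, v j - y j) = toLex (φ z - φ y, φ v - φ y) := by
  simp only [Prod.Lex.toLex_le_toLex] at hmin
  have hz (j) (hj : r j ≠ 0) : (z - y) j = φ z - φ y :=
    eq_of_dotProduct_le hr₁ (hr z)
      (fun j _ => (hmin j).elim le_of_lt fun h => h.1.le) hj
  have hv (j) (hj : r j ≠ 0) : (v - y) j = φ v - φ y :=
    eq_of_dotProduct_le hr₁ (hr v)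
      (fun j hj => (hmin j).elim (fun h => absurd (hz j hj) h.ne') And.right) hj
  exact ⟨hr.of_dotProduct_eq (dotProduct_eq_of_forall_eq hr₁ hv), fun j hj =>
    congrArg toLex (Prod.ext (hz j hj) (hv j hj))⟩

end Subgradient

theorem DiGraph.IsClass.hasAccess {ι : Type*} {G : DiGraph ι} {C : Set ι} (hC : G.IsClass C)
    {i j : ι} (hi : i ∈ C) (hj : j ∈ C) : G.HasAccess i j := by
  obtain ⟨k, -, rfl⟩ := hC
  exact hi.2.2.trans hj.2.1

theorem DiGraph.exists_isFinalClass_subset {ι : Type*} [Finite ι] {G : DiGraph ι} {K : Set ι}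
    (hK : K.Nonempty) (hnodes : K ⊆ G.nodes) (hclosed : ∀ i ∈ K, ∀ j, G.Arc i j → j ∈ K) :
    ∃ F ⊆ K, F.Nonempty ∧ G.IsFinalClass F := by
  have hacc {i j : ι} (hi : i ∈ K) (hij : G.HasAccess i j) : j ∈ K := by
    induction hij with
    | refl => exact hi
    | tail _ h ih => exact hclosed _ ih _ h
  obtain ⟨i, hi, hmin⟩ := K.toFinite.exists_minimalFor (fun i => {j | G.HasAccess i j}) K hK
  have hback {j : ι} (hij : G.HasAccess i j) : G.HasAccess j i :=
    hmin (hacc hi hij) (fun _ => hij.trans) .refl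
  exact ⟨{j | j ∈ G.nodes ∧ G.HasAccess i j ∧ G.HasAccess j i}, fun j hj => hacc hi hj.2.1,
    ⟨i, hnodes hi, .refl, .refl⟩, ⟨i, hnodes hi, rfl⟩, fun j hj k hk hjk =>
      ⟨hk, hj.2.1.trans hjk, hback (hj.2.1.trans hjk)⟩⟩

variable {n : ℕ}

section FinalClass

variable {P : Matrix (Fin n) (Fin n) ℝ} {F : Set (Fin n)}

theorem row_mem_stdSimplex (hP : P ∈ rowStochastic ℝ (Fin n)) (i : Fin n) :
    P i ∈ stdSimplex ℝ (Fin n) :=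
  ⟨fun _ => nonneg_of_mem_rowStochastic hP, sum_row_of_mem_rowStochastic hP i⟩

theorem mulVec_eq_of_mulVec_le (hP : P ∈ rowStochastic ℝ (Fin n))
    (hF : (matrixGraph P).IsFinalClass F) {h : Fin n → ℝ} (hle : ∀ i ∈ F, (P *ᵥ h) i ≤ h i) :
    ∀ i ∈ F, (P *ᵥ h) i = h i := by
  intro i hi
  obtain ⟨k, hk, hmin⟩ := Set.exists_min_image F h F.toFinite ⟨i, hi⟩
  have hconst {j : Fin n} (hkj : (matrixGraph P).HasAccess k j) : h j = h k := by
    induction hkj with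
    | refl => rfl
    | @tail c d hkc hcd ih =>
      have hc : c ∈ F := hF.2 k hk c trivial hkc
      refine eq_of_dotProduct_le (row_mem_stdSimplex hP c) ((hle c hc).trans_eq ih)
        (fun j hj => hmin j ?_) hcd
      exact hF.2 c hc j trivial (.single hj)
  have hki := hF.1.hasAccess hk hi
  rw [hconst hki]
  exact dotProduct_eq_of_forall_eq (row_mem_stdSimplex hP i) fun j hj => hconst (hki.tail hj)

theorem mulVec_eq_succ_of_mulVec_le (hP : P ∈ rowStochastic ℝ (Fin n))
    (hF : (matrixGraph P).IsFinalClass F) {u : ℕ → Fin n → ℝ} {p : ℕ} (hu : u p = u 0)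
    (hle : ∀ t < p, ∀ i ∈ F, (P *ᵥ u t) i ≤ u (t + 1) i) :
    ∀ t < p, ∀ i ∈ F, (P *ᵥ u t) i = u (t + 1) i := by
  have hshift : ∑ t ∈ Finset.range p, u (t + 1) = ∑ t ∈ Finset.range p, u t := by
    rw [← sub_eq_zero, ← Finset.sum_sub_distrib, Finset.sum_range_sub, hu, sub_self]
  have hmul (i : Fin n) : (P *ᵥ ∑ t ∈ Finset.range p, u t) i =
      ∑ t ∈ Finset.range p, (P *ᵥ u t) i := by
    rw [mulVec_sum, Finset.sum_apply]
  have hle' (i) (hi : i ∈ F) : ∀ t ∈ Finset.range p, (P *ᵥ u t) i ≤ u (t + 1) i :=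
    fun t ht => hle t (Finset.mem_range.1 ht) i hi
  have hsum := mulVec_eq_of_mulVec_le hP hF (h := ∑ t ∈ Finset.range p, u t) fun i hi => by
    rw [hmul, ← hshift, Finset.sum_apply]
    exact Finset.sum_le_sum (hle' i hi)
  intro t ht i hi
  have h := hsum i hi
  rw [hmul, ← hshift, Finset.sum_apply] at h
  exact (Finset.sum_eq_sum_iff_of_le (hle' i hi)).1 h t (Finset.mem_range.2 ht)

theorem eq_of_mulVec_le_succ (hP : P ∈ rowStochastic ℝ (Fin n))
    (hF : (matrixGraph P).IsFinalClass F) {u : ℕ → Fin n → ℝ} {p : ℕ} (hu : u p = u 0)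
    (hle : ∀ t < p, ∀ i ∈ F, (P *ᵥ u t) i ≤ u (t + 1) i) {t : ℕ} (ht : t < p) {i j : Fin n}
    (hi : i ∈ F) (hij : P i j ≠ 0) : u (t + 1) i = u t j := by
  have hmean := mulVec_eq_succ_of_mulVec_le hP hF hu hle
  -- By Jensen, the opposite squares satisfy the same inequality, so there is equality in Jensen.
  have hsq := mulVec_eq_succ_of_mulVec_le hP hF (u := fun t => -u t ^ 2) (p := p)
    (congrArg (fun w => -w ^ 2) hu) fun t ht i hi => by
      have h := sq_dotProduct_le (u := u t) (row_mem_stdSimplex hP i)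
      rw [mulVec_neg, Pi.neg_apply, Pi.neg_apply, neg_le_neg_iff, Pi.pow_apply, ← hmean t ht i hi]
      exact h
  have heq : (P i ⬝ᵥ u t) ^ 2 = P i ⬝ᵥ u t ^ 2 := by
    have h := hsq t ht i hi
    rw [mulVec_neg, Pi.neg_apply, Pi.neg_apply, neg_inj, Pi.pow_apply, ← hmean t ht i hi] at h
    exact h.symm
  rw [← hmean t ht i hi]
  exact (eq_dotProduct_of_sq_dotProduct_eq (row_mem_stdSimplex hP i) heq hij).symm

end FinalClass

variable {f : (Fin n → ℝ) → Fin n → ℝ} {v : Fin n → ℝ} {p : ℕ}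

theorem IsConvexMap.continuous (hconv : IsConvexMap f) : Continuous f :=
  continuous_pi fun i => (hconv i).locallyLipschitz.continuous

section Eigenvector

theorem IsHomogeneous.iterate (hhom : IsHomogeneous f) (m : ℕ) : IsHomogeneous f^[m] := by
  intro a x
  induction m generalizing x with
  | zero => rfl
  | succ m ih => rw [iterate_succ_apply, hhom, ih, iterate_succ_apply]

theorem IsHomogeneous.iterate_apply_eq (hhom : IsHomogeneous f) {a : ℝ}
    (hv : f v = fun i => a + v i) (m : ℕ) : f^[m] v = fun i => m * a + v i := by
  induction m with
  | zero => simp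
  | succ m ih =>
    rw [iterate_succ_apply, hv, hhom.iterate, ih]
    ext i
    push_cast
    ring

theorem eigenvalue_le [Nonempty (Fin n)] (hmono : Monotone f) (hhom : IsHomogeneous f)
    {v w : Fin n → ℝ} {a b : ℝ} (hv : f v = fun i => a + v i) (hw : f w = fun i => b + w i) :
    a ≤ b := by
  obtain ⟨i, hi⟩ := Finite.exists_max fun i => v i - w i
  have hle : f v ≤ f fun j => (v i - w i) + w j := hmono fun j => by linarith [hi j]
  rw [hhom, hv, hw] at hle
  linarith [hle i]

theorem IsEigenvector.isFixedPt (hmono : Monotone f) (hhom : IsHomogeneous f) {x : Fin n → ℝ}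
    (hp : 0 < p) (hx : IsPeriodicPt f p x) (hv : IsEigenvector f v) : IsFixedPt f v := by
  rcases isEmpty_or_nonempty (Fin n) with _ | _
  · exact Subsingleton.elim _ _
  obtain ⟨a, ha⟩ := hv
  have hvp := hhom.iterate_apply_eq ha p
  have hxp : f^[p] x = fun i => 0 + x i := by simpa using hx.eq
  have hpa : (p : ℝ) * a = 0 := le_antisymm
    (eigenvalue_le (hmono.iterate p) (hhom.iterate p) hvp hxp)
    (eigenvalue_le (hmono.iterate p) (hhom.iterate p) hxp hvp)
  have ha₀ : a = 0 := (mul_eq_zero.1 hpa).resolve_left (by positivity)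
  rw [IsFixedPt, ha, ha₀]
  exact funext fun i => zero_add (v i)

theorem exists_isFixedPt_of_isPeriodicPt (hcont : Continuous f) (hmono : Monotone f)
    (hhom : IsHomogeneous f) {x : Fin n → ℝ} (hp : 0 < p) (hx : IsPeriodicPt f p x) :
    ∃ v, IsFixedPt f v := by
  set O := Set.range fun t => f^[t] x
  have hub : ∀ y ∈ O, y ≤ sSup O := fun y hy => le_csSup (finite_range_iterate hp hx).bddAbove hy
  have hle : sSup O ≤ f (sSup O) := by
    refine csSup_le (Set.range_nonempty _) fun y hy => ?_
    obtain ⟨z, hz, rfl⟩ := surjOn_range_iterate hp hx hy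
    exact hmono (hub z hz)
  obtain ⟨M, hM⟩ := (Set.finite_range fun i => sSup O i - x i).bddAbove
  refine exists_isFixedPt_of_le_map hcont hmono hle ⟨fun i => M + sSup O i, ?_⟩
  rintro _ ⟨t, rfl⟩
  calc f^[t] (sSup O) ≤ f^[t] fun i => M + x i :=
        hmono.iterate t fun i => by linarith [hM ⟨i, rfl⟩]
    _ = fun i => M + f^[t] x i := hhom.iterate t M x
    _ ≤ fun i => M + sSup O i := fun i => add_le_add_right (hub _ ⟨t, rfl⟩ i) M

end Eigenvector

section CriticalGraph

theorem mem_subdifferential_iff {P : Matrix (Fin n) (Fin n) ℝ} :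
    P ∈ subdifferential f v ↔ ∀ i, IsSubgradientAt (fun y => f y i) (P i) v :=
  forall_comm

theorem IsSubgradientAt.mem_stdSimplex_of_isHomogeneous (hmono : Monotone f)
    (hhom : IsHomogeneous f) {i : Fin n} {r : Fin n → ℝ}
    (hr : IsSubgradientAt (fun y => f y i) r v) : r ∈ stdSimplex ℝ (Fin n) :=
  hr.mem_stdSimplex (fun _ _ h => hmono h i) fun a y => congrFun (hhom a y) i

theorem subdifferential_subset_rowStochastic (hmono : Monotone f) (hhom : IsHomogeneous f) :
    subdifferential f v ⊆ rowStochastic ℝ (Fin n) := fun P hP => by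
  have h (i) := (mem_subdifferential_iff.1 hP i).mem_stdSimplex_of_isHomogeneous hmono hhom
  exact mem_rowStochastic_iff_sum.2 ⟨fun i => (h i).1, fun i => (h i).2⟩

theorem exists_mem_criticalGraph_nodes (hconv : IsConvexMap f) {K : Set (Fin n)}
    (hK : K.Nonempty) (hrow : ∀ i ∈ K, ∃ r, IsSubgradientAt (fun y => f y i) r v ∧
      ∀ j, r j ≠ 0 → j ∈ K) : ∃ k ∈ K, k ∈ (criticalGraph f v).nodes := by
  have hrow' (i : Fin n) : ∃ r, IsSubgradientAt (fun y => f y i) r v ∧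
      (i ∈ K → ∀ j, r j ≠ 0 → j ∈ K) := by
    by_cases hi : i ∈ K
    · exact (hrow i hi).imp fun r hr => ⟨hr.1, fun _ => hr.2⟩
    · exact (exists_isSubgradientAt (hconv i) v).imp fun r hr => ⟨hr, fun h => absurd h hi⟩
  choose P hP hPK using hrow'
  obtain ⟨F, hFK, ⟨k, hk⟩, hF⟩ := DiGraph.exists_isFinalClass_subset (G := matrixGraph P) hK
    (Set.subset_univ K) hPK
  exact ⟨k, hFK hk, ⟨P, mem_subdifferential_iff.2 hP⟩, ⟨F, hF⟩, trivial, hk⟩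

theorem le_of_eqOn_criticalGraph_nodes (hconv : IsConvexMap f) (hmono : Monotone f)
    (hhom : IsHomogeneous f) (hv : IsFixedPt f v) {O : Set ((Fin n → ℝ) × (Fin n → ℝ))}
    (hO : O.Finite) (hsurj : Set.SurjOn (Prod.map f f) O O)
    (heq : ∀ q ∈ O, Set.EqOn q.1 q.2 (criticalGraph f v).nodes) : ∀ q ∈ O, q.1 ≤ q.2 := by
  intro q hq i
  let gap (q : (Fin n → ℝ) × (Fin n → ℝ)) (i : Fin n) : ℝ ×ₗ ℝ :=
    toLex (q.2 i - q.1 i, v i - q.1 i)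
  obtain ⟨m, hm, hmin⟩ := Set.exists_min_image (O ×ˢ Set.univ) (fun a => gap a.1 a.2)
    (hO.prod Set.finite_univ) ⟨(q, i), hq, trivial⟩
  -- The nodes of lexicographically least gap are closed under suitable subgradients at `v`, so
  -- one of them is critical, and the least value of `q.2 i - q.1 i` is zero.
  obtain ⟨k, ⟨o, ho, hok⟩, hk⟩ := exists_mem_criticalGraph_nodes (f := f) (v := v) hconv
    (K := {k | ∃ o ∈ O, gap o k = gap m.1 m.2}) ⟨m.2, m.1, hm.1, rfl⟩ <| by
      rintro k ⟨o, ho, hok⟩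
      obtain ⟨⟨y, z⟩, hyz, rfl⟩ := hsurj ho
      obtain ⟨r, hr⟩ := exists_isSubgradientAt (hconv k) y
      have hgap : toLex (f z k - f y k, f v k - f y k) = gap m.1 m.2 := by
        rw [hv.eq]
        exact hok
      obtain ⟨hrv, hrK⟩ := hr.of_toLex_le (hr.mem_stdSimplex_of_isHomogeneous hmono hhom)
        fun j => hgap.trans_le (hmin ((y, z), j) ⟨hyz, trivial⟩)
      exact ⟨r, hrv, fun j hj => ⟨(y, z), hyz, (hrK j hj).trans hgap⟩⟩
  have hle : gap o k ≤ gap q i := hok.trans_le (hmin (q, i) ⟨hq, trivial⟩)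
  have hfst : o.2 k - o.1 k ≤ q.2 i - q.1 i := Prod.Lex.monotone_fst _ _ hle
  rw [heq o ho hk, sub_self] at hfst
  exact sub_nonneg.1 hfst

theorem le_of_iterate_eqOn_criticalGraph_nodes (hconv : IsConvexMap f) (hmono : Monotone f)
    (hhom : IsHomogeneous f) (hv : IsFixedPt f v) (hp : 0 < p) {y z : Fin n → ℝ}
    (hy : IsPeriodicPt f p y) (hz : IsPeriodicPt f p z)
    (heq : ∀ t, Set.EqOn (f^[t] y) (f^[t] z) (criticalGraph f v).nodes) : y ≤ z := by
  have hyz : IsPeriodicPt (Prod.map f f) p (y, z) := by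
    rw [IsPeriodicPt, Prod.map_iterate]
    exact Prod.ext hy hz
  refine le_of_eqOn_criticalGraph_nodes hconv hmono hhom hv (finite_range_iterate hp hyz)
    (surjOn_range_iterate hp hyz) ?_ (y, z) ⟨0, rfl⟩
  rintro _ ⟨t, rfl⟩
  simpa only [Prod.map_iterate, Prod.map_apply] using heq t

end CriticalGraph

section Propagation

variable {l m : ℕ} {i j k : Fin n}

/-- The value at `j` of the difference to `v` of a point of period `p` reappears at `i` after `l`
iterations of `f`. -/
def Propagates (f : (Fin n → ℝ) → Fin n → ℝ) (v : Fin n → ℝ) (p l : ℕ) (i j : Fin n) : Prop :=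
  ∀ y, IsPeriodicPt f p y → f^[l] y i - v i = y j - v j

theorem Propagates.trans (hij : Propagates f v p l i j) (hjk : Propagates f v p m j k) :
    Propagates f v p (l + m) i k := fun y hy => by
  rw [iterate_add_apply, hij _ (hy.apply_iterate m), hjk y hy]

theorem Propagates.conj (hij : Propagates f v p l i j) (hi : Propagates f v p m i i) :
    Propagates f v p m j j := fun y hy => by
  rw [← hij _ (hy.apply_iterate m), ← hij y hy, ← iterate_add_apply, add_comm, iterate_add_apply,
    hi _ (hy.apply_iterate l)]

theorem propagates_one_of_arc (hmono : Monotone f) (hhom : IsHomogeneous f) (hv : IsFixedPt f v)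
    (hp : 0 < p) (hij : (criticalGraph f v).Arc i j) : Propagates f v p 1 i j := by
  obtain ⟨⟨P, hP⟩, ⟨F, hF⟩, hPij, hi, -⟩ := hij
  intro y hy
  refine eq_of_mulVec_le_succ (subdifferential_subset_rowStochastic hmono hhom hP) hF
    (u := fun t => f^[t] y - v) (by simp only [hy.eq, iterate_zero_apply]) (fun t _ k _ => ?_)
    hp hi hPij
  have h := hP (f^[t] y) k
  rwa [hv.eq, ← iterate_succ_apply' f] at h

theorem Propagates.of_walk {G : DiGraph (Fin n)} (hG : ∀ i j, G.Arc i j → Propagates f v p 1 i j)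
    {q : ℕ → Fin n} (hq : ∀ t < m, G.Arc (q t) (q (t + 1))) :
    Propagates f v p m (q 0) (q m) := by
  induction m with
  | zero => exact fun _ _ => rfl
  | succ m ih => exact (ih fun t ht => hq t (by omega)).trans (hG _ _ (hq m (by omega)))

theorem Propagates.of_hasAccess {G : DiGraph (Fin n)}
    (hG : ∀ i j, G.Arc i j → Propagates f v p 1 i j) (hij : G.HasAccess i j) :
    ∃ l, Propagates f v p l i j := by
  induction hij with
  | refl => exact ⟨0, fun _ _ => rfl⟩
  | tail _ h ih =>
    obtain ⟨l, hl⟩ := ih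
    exact ⟨l + 1, hl.trans (hG _ _ h)⟩

theorem Propagates.of_setGcd_dvd (hp : 0 < p) {s : Set ℕ} (hs : ∀ m ∈ s, Propagates f v p m i i)
    (hm : Nat.setGcd s ∣ m) : Propagates f v p m i i := by
  have hclosure : ∀ m ∈ AddSubmonoid.closure s, Propagates f v p m i i := fun m hm => by
    induction hm using AddSubmonoid.closure_induction with
    | mem m hm => exact hs m hm
    | zero => exact fun _ _ => rfl
    | add l m _ _ hl hm => exact hl.trans hm
  obtain ⟨N, hN⟩ := Nat.exists_mem_closure_of_ge s
  rcases m.eq_zero_or_pos with rfl | hm₀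
  · exact fun _ _ => rfl
  -- Large multiples of the gcd lie in the closure; choose one congruent to `m` modulo `p`.
  have hlarge : N ≤ m + p * (m * N) := by nlinarith [Nat.mul_pos hp hm₀]
  have hdvd : Nat.setGcd s ∣ m + p * (m * N) :=
    dvd_add hm ((hm.mul_right N).mul_left p)
  intro y hy
  have h := hclosure _ (hN _ hlarge hdvd) y hy
  rwa [iterate_add_apply, (hy.mul_const _).eq] at h

theorem Propagates.cyclicity {G : DiGraph (Fin n)}
    (hG : ∀ i j, G.Arc i j → Propagates f v p 1 i j) (hp : 0 < p) (hi : i ∈ G.nodes) :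
    Propagates f v p G.cyclicity i i := by
  let C : Set (Fin n) := {j | j ∈ G.nodes ∧ G.HasAccess i j ∧ G.HasAccess j i}
  have hC : C ∈ (Set.toFinite {C : Set (Fin n) | G.IsClass C}).toFinset :=
    (Set.Finite.mem_toFinset _).2 ⟨i, hi, rfl⟩
  refine .of_setGcd_dvd hp ?_ (Finset.dvd_lcm (f := fun C => (G.restrict C).circuitGcd) hC)
  rintro m ⟨hm, q, hq, hclosed⟩
  have hloop : Propagates f v p m (q 0) (q m) := .of_walk hG fun t ht => (hq t ht).1
  obtain ⟨l, hl⟩ := Propagates.of_hasAccess hG (hq 0 hm).2.1.2.2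
  exact hl.conj (hclosed ▸ hloop)

end Propagation

end ConvexSpectral

theorem theorem5p6 {n : ℕ} (f : (Fin n → ℝ) → (Fin n → ℝ))
    (hconv : ConvexSpectral.IsConvexMap f) (hmono : Monotone f)
    (hhom : ConvexSpectral.IsHomogeneous f)
    (x : Fin n → ℝ) (hx : x ∈ Function.periodicPts f) :
    (∃ v, ConvexSpectral.IsEigenvector f v) ∧
      ∀ v, ConvexSpectral.IsEigenvector f v →
        Function.minimalPeriod f x ∣ (ConvexSpectral.criticalGraph f v).cyclicity := by
  open ConvexSpectral in
  obtain ⟨p, hp, hxp⟩ := hx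
  refine ⟨?_, fun v hv => Function.IsPeriodicPt.minimalPeriod_dvd ?_⟩
  · obtain ⟨v, hv⟩ := exists_isFixedPt_of_isPeriodicPt hconv.continuous hmono hhom hp hxp
    exact ⟨v, 0, by simpa using hv.eq⟩
  set c := (criticalGraph f v).cyclicity
  have hfix : Function.IsFixedPt f v := hv.isFixedPt hmono hhom hp hxp
  have heq (t : ℕ) : Set.EqOn (f^[t] (f^[c] x)) (f^[t] x) (criticalGraph f v).nodes := by
    intro i hi
    have h := Propagates.cyclicity (fun _ _ => propagates_one_of_arc hmono hhom hfix hp) hp hi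
      (f^[t] x) (hxp.apply_iterate t)
    rw [← Function.iterate_add_apply, add_comm, Function.iterate_add_apply]
    exact sub_left_inj.1 h
  exact le_antisymm
    (le_of_iterate_eqOn_criticalGraph_nodes hconv hmono hhom hfix hp (hxp.apply_iterate c) hxp heq)
    (le_of_iterate_eqOn_criticalGraph_nodes hconv hmono hhom hfix hp hxp (hxp.apply_iterate c)
      fun t => (heq t).symm)
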